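/- **Theorem 2 (Inequality of Effective Capacity).** Time is divided into slots of unit length; all amounts of data are in bits per slot. Let $\beta,\gamma,T_s>0$ be real, $k_s,N\ge 1$ integers, and put $\lambda_u=\beta k_s/T_s$ and $c=\frac{N\gamma}{\beta k_s}$. For $i\in\{u,d\}$ (uplink, downlink) let $W_i,L_i,\theta_i>0$ and $0<e_i<1$, let $(\mathrm{SNR}_i(n))_{n\ge0}$ be i.i.d. nonnegative random variables, and let $$R_i(n)=W_i\log_2(1+\mathrm{SNR}_i(n))-\sqrt{V_i(n)/L_i}\;f_Q^{-1}(e_i),\qquad V_i(n)=1-\frac1{(1+\mathrm{SNR}_i(n))^2},$$ where $f_Q$ is the complementary standard Gaussian distribution function. Assume $\mathbb E\,e^{\eta R_u(0)}<\infty$ for all $\eta\in\mathbb R$. The effective capacities are $C_i(\theta)=-\frac1\theta\log\mathbb E\,e^{-\theta R_i(0)}$, $\theta\neq0$. A *steady-state queue* with arrivals $a(n)$ and service $r(n)$ is a process $q(n)$ with $q(0)\ge0$, $q(n+1)=\max(q(n)+a(n)-r(n),0)$ and all $q(n)$ identically distributed; it has *decay rate* $\theta$ if $\lim_{x\to\infty}\frac1x\ln\Pr\{q(0)\ge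 x\}=-\theta$. A process $a(n)$ has *effective bandwidth* $\alpha$ at $\theta>0$ if $\mathbb E\,e^{\theta\sum_{n<t}a(n)}<\infty$ for all $t$ and $\frac1{\theta t}\log\mathbb E\,e^{\theta\sum_{n<t}a(n)}\to\alpha$ as $t\to\infty$. Let $q_u$ be a steady-state queue with constant arrivals $\lambda_u$, service $R_u$ and decay rate $\theta_u$, with $q_u(0)$ independent of $(\mathrm{SNR}_u(n))_n$, and let $d_u(n)=q_u(n)+\lambda_u-q_u(n+1)$ be its departure process. For $\theta>0$ set $$L_u(\theta)=\begin{cases}\lambda_u,&\theta\le\theta_u,\\[2pt] \dfrac{(\theta-\theta_u)\,C_u(\theta_u-\theta)+\lambda_u\theta_u}{\theta},&\theta>\theta_u.\end{cases}$$ Then: 1. $C_u(\theta_u)\ge\lambda_u=\beta k_s/T_s$. 2. The effective bandwidth of the departure process $d_u$ at $\theta_d$ (the uplink departure rate) exists and equals $L_u(\theta_d)$. 3. Let $q_d$ be a steady-state queue with service $R_d$, decay rate $\theta_d$, and an arrival process $a_d$ independent of $(\mathrm{SNR}_d(n))_n$. Suppose that $a_d$ has an effective bandwidth at every $\theta$ near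 $\theta_d$ and that its arrival rate $\lambda_d$, meaning its effective bandwidth at $\theta_d$, is $\frac{N\gamma}{\beta k_s}$ times the uplink departure rate. Then $C_d(\theta_d)\ge\lambda_d=\frac{N\gamma}{\beta k_s}L_u(\theta_d)$. 4. If instead $a_d(n)=c\,d_u(n)$ in every slot (the other assumptions on $q_d$, $a_d$ being as in the first sentence of 3), then $C_d(\theta_d)\ge c\,L_u(c\,\theta_d)$; and if moreover $c\ge1$ or $\theta_d\le\theta_u$, then $C_d(\theta_d)\ge\frac{N\gamma}{\beta k_s}L_u(\theta_d)$. -/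

import Mathlib

open MeasureTheory ProbabilityTheory Filter Topology

noncomputable section

namespace TandemQueue

/-- The complementary distribution function of the standard Gaussian law. -/
def gaussianQ (x : ℝ) : ℝ := (gaussianReal 0 1).real (Set.Ioi x)

/-- The inverse of `gaussianQ`; it is only evaluated at points of `(0, 1)`, the range of
the injective function `gaussianQ`. -/
def gaussianQInv (e : ℝ) : ℝ := Function.invFun gaussianQ e

/-- Channel dispersion at signal-to-noise ratio `s`. -/
def dispersion (s : ℝ) : ℝ := 1 - 1 / (1 + s) ^ 2

/-- Finite-blocklength service rate with bandwidth `W`, blocklength `L`, distortion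
probability `e` and signal-to-noise ratio `s`. -/
def rate (W L e s : ℝ) : ℝ :=
  W * Real.logb 2 (1 + s) - Real.sqrt (dispersion s / L) * gaussianQInv e

variable {Ω : Type*} [MeasurableSpace Ω]

/-- The signal-to-noise ratios of successive time slots: nonnegative, independent and
identically distributed. -/
structure IsChannel (μ : Measure Ω) (snr : ℕ → Ω → ℝ) : Prop where
  measurable : ∀ n, Measurable (snr n)
  nonneg : ∀ n ω, 0 ≤ snr n ω
  indep : iIndepFun snr μ
  identDistrib : ∀ n, IdentDistrib (snr n) (snr 0) μ μ

/-- Service process: the bits served in slot `n`. -/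
def service (W L e : ℝ) (snr : ℕ → Ω → ℝ) (n : ℕ) (ω : Ω) : ℝ := rate W L e (snr n ω)

/-- Effective capacity `-(1/θ) log E exp(-θ R)` of a random service rate `R`. -/
def effectiveCapacity (μ : Measure Ω) (R : Ω → ℝ) (θ : ℝ) : ℝ :=
  -(1 / θ) * Real.log (∫ ω, Real.exp (-θ * R ω) ∂μ)

/-- `q` is the backlog process, in steady state, of the queue with arrivals `a` and
service `r` (amounts per slot). -/
structure IsSteadyQueue (μ : Measure Ω) (a r q : ℕ → Ω → ℝ) : Prop where
  measurable : ∀ n, Measurable (q n)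
  nonneg_zero : ∀ ω, 0 ≤ q 0 ω
  step : ∀ n ω, q (n + 1) ω = max (q n ω + a n ω - r n ω) 0
  steady : ∀ n, IdentDistrib (q n) (q 0) μ μ

/-- The overflow probability of the backlog `q` decays at exponential rate `θ`. -/
def HasDecayRate (μ : Measure Ω) (q : Ω → ℝ) (θ : ℝ) : Prop :=
  Tendsto (fun x : ℝ => Real.log (μ.real {ω | x ≤ q ω}) / x) atTop (𝓝 (-θ))

/-- The amount leaving a queue with arrivals `a` and backlog `q` in slot `n`. -/
def departures (a q : ℕ → Ω → ℝ) (n : ℕ) (ω : Ω) : ℝ := q n ω + a n ω - q (n + 1) ω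

/-- The process `a` (amounts per slot) has effective bandwidth `α` at exponent `θ`:
`α = lim (1 / (θ t)) log E exp(θ (a 0 + ... + a (t - 1)))`. -/
def HasEffectiveBandwidth (μ : Measure Ω) (a : ℕ → Ω → ℝ) (θ α : ℝ) : Prop :=
  (∀ t : ℕ, Integrable (fun ω => Real.exp (θ * ∑ n ∈ Finset.range t, a n ω)) μ) ∧
  Tendsto (fun t : ℕ =>
      1 / (θ * t) * Real.log (∫ ω, Real.exp (θ * ∑ n ∈ Finset.range t, a n ω) ∂μ))
    atTop (𝓝 α)

/-- The uplink departure rate at downlink exponent `θd`, for arrival rate `lam`, uplink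
effective capacity function `C` and uplink exponent `θu`. -/
def departureRate (lam : ℝ) (C : ℝ → ℝ) (θu θd : ℝ) : ℝ :=
  if θd ≤ θu then lam else ((θd - θu) * C (θu - θd) + lam * θu) / θd

end TandemQueue

end

namespace TandemQueue

variable {Ω : Type*} [MeasurableSpace Ω] {μ : Measure Ω}

/-! Put X n = R_u(n) - λ_u, S_t = X 0 + ... + X (t-1), and let Λ be the cumulant generating function
of X 0. The uplink backlog is a stationary walk with steps -X n, reflected at 0.

Uplink: stationarity and q 1 ≥ q 0 - X 0 give Λ(-η) ≤ 0 for η < θu, where E exp(η q 0) is finite;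
continuity extends this to η = θu, which is the inequality for the effective capacity.

Departures: they sum to t λ_u + q 0 - q t, so the effective bandwidth is read off from the growth
rate of E exp(θ (q 0 - q t)), which is Λ(max(θ - θu, 0)) (`tendsto_log_integral_exp_sub`). For the
upper bound, q 0 - q t is at most both q 0 and S_t; spend an exponent just below min(θ, θu) on q 0,
the rest on S_t, and use independence. For the lower bound when θ > θu, the walk is unreflected
while q 0 dominates the running maximum M_t, and given the steps this has probability at least c
exp(-κ M_t) for any κ > θu. A reversed use of Hölder shows that the penalty costs only a polynomial
factor. When θ ≤ θu, stationarity alone gives a positive lower bound uniform in t.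

Downlink: q t ≥ (arrivals) - (service), so boundedness of E exp(θ q t) forces bandwidth ≤ capacity
for θ < θd. Both sides are continuous at θd, the bandwidth because θ times it is a limit of convex
functions. Slotwise scaling by c turns L_u(θ) into c L_u(c θ), and monotonicity of L_u gives the
last claim. -/

/-! ### Cumulant generating functions and i.i.d. sums -/

lemma integrable_exp_convex_comb {U V : Ω → ℝ} (hU : Measurable U) (hV : Measurable V)
    (hUi : Integrable (fun ω => Real.exp (U ω)) μ) (hVi : Integrable (fun ω => Real.exp (V ω)) μ)
    {p q : ℝ} (hp : 0 ≤ p) (hq : 0 ≤ q) (hpq : p + q = 1) :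
    Integrable (fun ω => Real.exp (p * U ω + q * V ω)) μ := by
  refine ((hUi.const_mul p).add (hVi.const_mul q)).mono'
    (by fun_prop) (ae_of_all _ fun ω => ?_)
  rw [Real.norm_eq_abs, Real.abs_exp]
  exact convexOn_exp.2 (Set.mem_univ _) (Set.mem_univ _) hp hq hpq

/-- Hölder's inequality in logarithmic form. -/
lemma log_integral_exp_convex_comb_le [IsProbabilityMeasure μ] {U V : Ω → ℝ}
    (hU : Measurable U) (hV : Measurable V)
    (hUi : Integrable (fun ω => Real.exp (U ω)) μ) (hVi : Integrable (fun ω => Real.exp (V ω)) μ)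
    {p q : ℝ} (hp : 0 ≤ p) (hq : 0 ≤ q) (hpq : p + q = 1) :
    Real.log (∫ ω, Real.exp (p * U ω + q * V ω) ∂μ) ≤
      p * Real.log (∫ ω, Real.exp (U ω) ∂μ) + q * Real.log (∫ ω, Real.exp (V ω) ∂μ) := by
  have hi := integrable_exp_convex_comb hU hV hUi hVi hp hq hpq
  have h := ENNReal.lintegral_mul_norm_pow_le (μ := μ)
    (f := fun ω => ENNReal.ofReal (Real.exp (U ω))) (g := fun ω => ENNReal.ofReal (Real.exp (V ω)))
    (by fun_prop) (by fun_prop) hp hq hpq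
  have e : ∀ ω, ENNReal.ofReal (Real.exp (U ω)) ^ p * ENNReal.ofReal (Real.exp (V ω)) ^ q
      = ENNReal.ofReal (Real.exp (p * U ω + q * V ω)) := fun ω => by
    rw [ENNReal.ofReal_rpow_of_pos (Real.exp_pos _), ENNReal.ofReal_rpow_of_pos (Real.exp_pos _),
      ← ENNReal.ofReal_mul (by positivity), ← Real.exp_mul, ← Real.exp_mul, ← Real.exp_add]
    ring_nf
  simp_rw [e] at h
  have hUp := integral_exp_pos hUi
  have hVp := integral_exp_pos hVi
  rw [← ofReal_integral_eq_lintegral_ofReal hi (ae_of_all _ fun _ => (Real.exp_pos _).le),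
    ← ofReal_integral_eq_lintegral_ofReal hUi (ae_of_all _ fun _ => (Real.exp_pos _).le),
    ← ofReal_integral_eq_lintegral_ofReal hVi (ae_of_all _ fun _ => (Real.exp_pos _).le),
    ENNReal.ofReal_rpow_of_pos hUp, ENNReal.ofReal_rpow_of_pos hVp,
    ← ENNReal.ofReal_mul (by positivity), ENNReal.ofReal_le_ofReal_iff (by positivity)] at h
  calc _ ≤ _ := Real.log_le_log (integral_exp_pos hi) h
    _ = _ := by
      rw [Real.log_mul (by positivity) (by positivity), Real.log_rpow hUp, Real.log_rpow hVp]

lemma convexOn_cgf [IsProbabilityMeasure μ] {X : Ω → ℝ} (hX : Measurable X) {s : Set ℝ}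
    (hs : Convex ℝ s) (hi : ∀ η ∈ s, Integrable (fun ω => Real.exp (η * X ω)) μ) :
    ConvexOn ℝ s (cgf X μ) := by
  refine ⟨hs, fun a ha b hb p q hp hq hpq => ?_⟩
  have h := log_integral_exp_convex_comb_le (hX.const_mul a) (hX.const_mul b) (hi a ha) (hi b hb)
    hp hq hpq
  have e : ∀ ω, (p * a + q * b) * X ω = p * (a * X ω) + q * (b * X ω) := fun ω => by ring
  simpa only [cgf, mgf, smul_eq_mul, e] using h

lemma continuous_cgf [IsProbabilityMeasure μ] {X : Ω → ℝ}
    (hi : ∀ η, Integrable (fun ω => Real.exp (η * X ω)) μ) : Continuous (cgf X μ) :=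
  (continuous_mgf hi).log fun η => (mgf_pos (hi η)).ne'

lemma integrable_exp_mul_sum_of_identDistrib {X : ℕ → Ω → ℝ} [IsProbabilityMeasure μ]
    (hm : ∀ n, Measurable (X n)) (hind : iIndepFun X μ)
    (hid : ∀ n, IdentDistrib (X n) (X 0) μ μ) {η : ℝ}
    (hi : Integrable (fun ω => Real.exp (η * X 0 ω)) μ) (t : ℕ) :
    Integrable (fun ω => Real.exp (η * ∑ n ∈ Finset.range t, X n ω)) μ := by
  have h := hind.integrable_exp_mul_sum hm (s := Finset.range t) (t := η) fun n _ =>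
    (((hid n).comp (u := fun x => Real.exp (η * x)) (by fun_prop)).integrable_iff).2 hi
  simpa only [Finset.sum_apply] using h

lemma integral_exp_mul_sum_of_identDistrib {X : ℕ → Ω → ℝ} [IsProbabilityMeasure μ]
    (hm : ∀ n, Measurable (X n)) (hind : iIndepFun X μ)
    (hid : ∀ n, IdentDistrib (X n) (X 0) μ μ) (η : ℝ) (t : ℕ) :
    ∫ ω, Real.exp (η * ∑ n ∈ Finset.range t, X n ω) ∂μ = mgf (X 0) μ η ^ t := by
  have h := hind.mgf_sum hm (t := η) (Finset.range t)
  rw [Finset.prod_congr rfl fun n _ => mgf_congr_of_identDistrib (X n) (X 0) (hid n) η] at h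
  simpa [mgf, Finset.sum_apply] using h

/-! ### Tail bounds and exponential moments from a decay rate -/

section Decay

variable [IsProbabilityMeasure μ] {q : Ω → ℝ} {θ : ℝ}

lemma HasDecayRate.exists_tail_le (h : HasDecayRate μ q θ) {η : ℝ} (hη : 0 ≤ η) (hηθ : η < θ) :
    ∃ K, ∀ x, 0 ≤ x → μ.real {ω | x ≤ q ω} ≤ K * Real.exp (-η * x) := by
  have h1 := (h.eventually_lt_const (neg_lt_neg hηθ)).and (eventually_gt_atTop 0)
  obtain ⟨x₀, hx₀⟩ := eventually_atTop.1 h1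
  have hx₀p := (hx₀ x₀ le_rfl).2
  -- This constant makes the bound at least 1, hence trivial, on [0, x₀].
  refine ⟨Real.exp (η * x₀), fun x hx => ?_⟩
  rw [← Real.exp_add]
  rcases le_total x₀ x with hxx | hxx
  · obtain ⟨h2, h3⟩ := hx₀ x hxx
    rw [div_lt_iff₀ h3] at h2
    rcases (measureReal_nonneg (μ := μ) (s := {ω | x ≤ q ω})).eq_or_lt with h0 | h0
    · rw [← h0]; positivity
    · rw [← Real.log_le_iff_le_exp h0]
      nlinarith
  · refine measureReal_le_one.trans (Real.one_le_exp ?_)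
    nlinarith

lemma HasDecayRate.exists_le_tail (h : HasDecayRate μ q θ) (hθ : 0 < θ) {κ : ℝ} (hκ : θ < κ) :
    ∃ c, 0 < c ∧ ∀ x, 0 ≤ x → c * Real.exp (-κ * x) ≤ μ.real {ω | x ≤ q ω} := by
  have h1 := ((h.eventually_const_lt (neg_lt_neg hκ)).and
    (h.eventually_lt_const (neg_lt_zero.2 hθ))).and (eventually_gt_atTop 0)
  obtain ⟨x₀, hx₀⟩ := eventually_atTop.1 h1
  have hx₀p := (hx₀ x₀ le_rfl).2
  have hκ0 : 0 < κ := hθ.trans hκ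
  have key : ∀ x, x₀ ≤ x → Real.exp (-κ * x) ≤ μ.real {ω | x ≤ q ω} := fun x hx => by
    obtain ⟨⟨h2, h3⟩, h4⟩ := hx₀ x hx
    -- Since `Real.log 0 = 0`, a vanishing tail would make the quotient 0; the strictly negative
    -- limit -θ excludes this.
    have h0 : 0 < μ.real {ω | x ≤ q ω} := by
      refine measureReal_nonneg.lt_of_ne fun h0 => ?_
      rw [← h0] at h3
      simp at h3
    rw [lt_div_iff₀ h4] at h2
    exact (Real.le_log_iff_exp_le h0).1 h2.le
  refine ⟨Real.exp (-κ * x₀), Real.exp_pos _, fun x hx => ?_⟩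
  rcases le_total x₀ x with hxx | hxx
  · refine le_trans ?_ (key x hxx)
    rw [← Real.exp_add]
    exact Real.exp_le_exp.2 (by nlinarith)
  · calc _ ≤ Real.exp (-κ * x₀) := by
          rw [← Real.exp_add]
          exact Real.exp_le_exp.2 (by nlinarith)
      _ ≤ _ := key x₀ le_rfl
      _ ≤ _ := measureReal_mono fun ω hω => hxx.trans hω

/-- Slice by the integer part of q: with η < ρ < θ, the slices are dominated by a geometric series
of ratio exp(η - ρ). -/
lemma HasDecayRate.integrable_exp_mul (h : HasDecayRate μ q θ) (hq : Measurable q)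
    (hq0 : ∀ ω, 0 ≤ q ω) {η : ℝ} (hη : 0 ≤ η) (hηθ : η < θ) :
    Integrable (fun ω => Real.exp (η * q ω)) μ := by
  obtain ⟨ρ, hηρ, hρθ⟩ := exists_between hηθ
  obtain ⟨K, hK⟩ := h.exists_tail_le (hη.trans hηρ.le) hρθ
  have hK0 : 0 ≤ K := by
    have := measureReal_nonneg.trans (hK 0 le_rfl)
    simpa using this
  refine ⟨by fun_prop, ?_⟩
  rw [hasFiniteIntegral_iff_ofReal (ae_of_all _ fun _ => (Real.exp_pos _).le)]
  have hS : ∀ n : ℕ, MeasurableSet {ω | (n : ℝ) ≤ q ω} := fun n => measurableSet_le (by fun_prop) hq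
  calc ∫⁻ ω, ENNReal.ofReal (Real.exp (η * q ω)) ∂μ
      ≤ ∫⁻ ω, ∑' n : ℕ, {ω | (n : ℝ) ≤ q ω}.indicator
          (fun _ => ENNReal.ofReal (Real.exp (η * (n + 1)))) ω ∂μ := by
        refine lintegral_mono fun ω => ?_
        refine le_trans ?_ (ENNReal.le_tsum ⌊q ω⌋₊)
        rw [Set.indicator_of_mem (show ω ∈ {ω' | (⌊q ω⌋₊ : ℝ) ≤ q ω'} from Nat.floor_le (hq0 ω))]
        refine ENNReal.ofReal_le_ofReal (Real.exp_le_exp.2 ?_)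
        exact mul_le_mul_of_nonneg_left (Nat.lt_floor_add_one _).le hη
    _ = ∑' n : ℕ, ENNReal.ofReal (Real.exp (η * (n + 1))) * μ {ω | (n : ℝ) ≤ q ω} := by
        rw [lintegral_tsum fun n => (measurable_const.indicator (hS n)).aemeasurable]
        simp_rw [lintegral_indicator_const (hS _)]
    _ ≤ ∑' n : ℕ, ENNReal.ofReal (K * Real.exp η * Real.exp (η - ρ) ^ n) := by
        refine ENNReal.tsum_le_tsum fun n => ?_
        rw [← ofReal_measureReal, ← ENNReal.ofReal_mul (Real.exp_pos _).le]
        refine ENNReal.ofReal_le_ofReal ?_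
        calc _ ≤ Real.exp (η * (n + 1)) * (K * Real.exp (-ρ * n)) := by
              gcongr
              exact hK n n.cast_nonneg
          _ = K * (Real.exp (η * (n + 1)) * Real.exp (-ρ * n)) := by ring
          _ = _ := by
              rw [← Real.exp_nat_mul, mul_assoc, ← Real.exp_add, ← Real.exp_add]
              ring_nf
    _ < ⊤ := by
        rw [← ENNReal.ofReal_tsum_of_nonneg (fun n => by positivity)]
        · exact ENNReal.ofReal_lt_top
        · exact (summable_geometric_of_lt_one (Real.exp_pos _).le
            (by rw [Real.exp_lt_one_iff]; linarith)).mul_left _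

end Decay

/-! ### Reflected walks: upper bounds on increments -/

/-- Fubini for independent variables, used to freeze the steps of the walk and integrate over its
initial value alone. -/
lemma lintegral_comp_prodMk_of_indepFun {α γ : Type*} [MeasurableSpace α] [MeasurableSpace γ]
    [IsProbabilityMeasure μ] {U : Ω → α} {V : Ω → γ} (hU : Measurable U) (hV : Measurable V)
    (h : IndepFun U V μ) {F : α × γ → ENNReal} (hF : Measurable F) :
    ∫⁻ ω, F (U ω, V ω) ∂μ = ∫⁻ ω, ∫⁻ ω', F (U ω', V ω) ∂μ ∂μ := by
  have := Measure.isProbabilityMeasure_map (μ := μ) hU.aemeasurable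
  have := Measure.isProbabilityMeasure_map (μ := μ) hV.aemeasurable
  rw [← lintegral_map hF (hU.prodMk hV),
    (indepFun_iff_map_prod_eq_prod_map_map hU.aemeasurable hV.aemeasurable).1 h,
    lintegral_prod_symm _ hF.aemeasurable,
    lintegral_map (Measurable.lintegral_prod_left' hF) hV]
  refine lintegral_congr fun ω => ?_
  rw [lintegral_map (by fun_prop) hU]

/-- `q` is a stationary random walk with i.i.d. steps `-X n` reflected at `0`, whose
stationary law has exponential decay rate `θ`. -/
structure IsReflectedWalk (μ : Measure Ω) (X q : ℕ → Ω → ℝ) (θ : ℝ) : Prop where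
  measurable_step : ∀ n, Measurable (X n)
  indep_step : iIndepFun X μ
  ident_step : ∀ n, IdentDistrib (X n) (X 0) μ μ
  integrable_exp : ∀ η, Integrable (fun ω => Real.exp (η * X 0 ω)) μ
  measurable : ∀ n, Measurable (q n)
  nonneg_zero : ∀ ω, 0 ≤ q 0 ω
  step : ∀ n ω, q (n + 1) ω = max (q n ω - X n ω) 0
  steady : ∀ n, IdentDistrib (q n) (q 0) μ μ
  indep_zero : IndepFun (q 0) (fun ω n => X n ω) μ
  decay : HasDecayRate μ (q 0) θ
  decay_pos : 0 < θ

namespace IsReflectedWalk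

variable {X q : ℕ → Ω → ℝ} {θu : ℝ}

lemma nonneg (h : IsReflectedWalk μ X q θu) (n : ℕ) (ω : Ω) : 0 ≤ q n ω := by
  cases n with
  | zero => exact h.nonneg_zero ω
  | succ n => rw [h.step]; exact le_max_right _ _

lemma sub_sum_le (h : IsReflectedWalk μ X q θu) (t : ℕ) (ω : Ω) :
    q 0 ω - ∑ n ∈ Finset.range t, X n ω ≤ q t ω := by
  induction t with
  | zero => simp
  | succ t ih =>
    rw [Finset.sum_range_succ, h.step]
    exact le_trans (by linarith) (le_max_left _ _)

lemma eq_sub_sum (h : IsReflectedWalk μ X q θu) (t : ℕ) (ω : Ω)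
    (hω : ∀ s ≤ t, ∑ n ∈ Finset.range s, X n ω ≤ q 0 ω) :
    q t ω = q 0 ω - ∑ n ∈ Finset.range t, X n ω := by
  induction t with
  | zero => simp
  | succ t ih =>
    have h1 := hω (t + 1) le_rfl
    rw [h.step, ih fun s hs => hω s (hs.trans t.le_succ)]
    rw [Finset.sum_range_succ] at h1 ⊢
    rw [max_eq_left (by linarith)]
    ring

lemma indep_zero_comp (h : IsReflectedWalk μ X q θu) {f : ℝ → ℝ} (hf : Measurable f)
    {g : (ℕ → ℝ) → ℝ} (hg : Measurable g) :
    IndepFun (fun ω => f (q 0 ω)) (fun ω => g (fun n => X n ω)) μ :=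
  h.indep_zero.comp hf hg

variable [IsProbabilityMeasure μ]

lemma integrable_exp_sum (h : IsReflectedWalk μ X q θu) (η : ℝ) (t : ℕ) :
    Integrable (fun ω => Real.exp (η * ∑ n ∈ Finset.range t, X n ω)) μ :=
  integrable_exp_mul_sum_of_identDistrib h.measurable_step h.indep_step h.ident_step
    (h.integrable_exp η) t

lemma integral_exp_sum (h : IsReflectedWalk μ X q θu) (η : ℝ) (t : ℕ) :
    ∫ ω, Real.exp (η * ∑ n ∈ Finset.range t, X n ω) ∂μ = mgf (X 0) μ η ^ t :=
  integral_exp_mul_sum_of_identDistrib h.measurable_step h.indep_step h.ident_step η t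

/-- Domination by the sum of steps avoids exponential moments of `q 0`, which are only available
below `θu`. -/
lemma integrable_exp_sub (h : IsReflectedWalk μ X q θu) {θ : ℝ} (hθ : 0 ≤ θ) (t : ℕ) :
    Integrable (fun ω => Real.exp (θ * (q 0 ω - q t ω))) μ := by
  have h0 := h.measurable 0
  have ht := h.measurable t
  refine (h.integrable_exp_sum θ t).mono' (by fun_prop) (ae_of_all _ fun ω => ?_)
  rw [Real.norm_eq_abs, Real.abs_exp, Real.exp_le_exp]
  exact mul_le_mul_of_nonneg_left (by linarith [h.sub_sum_le t ω]) hθ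

/-- By stationarity and independence, E exp(η q 0) = E exp(η q 1) ≥ E exp(η q 0) · E exp(-η X 0);
cancel the finite positive factor. -/
lemma cgf_neg_le_zero_of_lt (h : IsReflectedWalk μ X q θu) {η : ℝ} (hη : 0 ≤ η) (hηu : η < θu) :
    cgf (X 0) μ (-η) ≤ 0 := by
  have hi0 := h.decay.integrable_exp_mul (h.measurable 0) h.nonneg_zero hη hηu
  have hid := (h.steady 1).comp (u := fun x => Real.exp (η * x)) (by fun_prop)
  have hi1 : Integrable (fun ω => Real.exp (η * q 1 ω)) μ := hid.integrable_iff.2 hi0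
  have he : ∫ ω, Real.exp (η * q 1 ω) ∂μ = ∫ ω, Real.exp (η * q 0 ω) ∂μ := hid.integral_eq
  have hind := h.indep_zero_comp (f := fun x => Real.exp (η * x))
    (g := fun x => Real.exp (-η * x 0)) (by fun_prop) (by fun_prop)
  have hpos := integral_exp_pos hi0
  have hmul : (∫ ω, Real.exp (η * q 0 ω) ∂μ) * mgf (X 0) μ (-η) ≤
      ∫ ω, Real.exp (η * q 0 ω) ∂μ := by
    rw [← he, mgf, he, ← hind.integral_fun_mul_eq_mul_integral hi0.aestronglyMeasurable
      (h.integrable_exp (-η)).aestronglyMeasurable, ← he]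
    refine integral_mono (hind.integrable_mul hi0 (h.integrable_exp (-η))) hi1 fun ω => ?_
    simp only [← Real.exp_add, Real.exp_le_exp, h.step]
    have := mul_le_mul_of_nonneg_left (le_max_left (q 0 ω - X 0 ω) 0) hη
    linarith
  have h1 : mgf (X 0) μ (-η) ≤ 1 := by nlinarith
  exact Real.log_nonpos mgf_nonneg h1

lemma cgf_neg_le_zero (h : IsReflectedWalk μ X q θu) : cgf (X 0) μ (-θu) ≤ 0 := by
  have hc : Tendsto (fun η => cgf (X 0) μ (-η)) (𝓝[<] θu) (𝓝 (cgf (X 0) μ (-θu))) :=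
    (((continuous_cgf h.integrable_exp).comp continuous_neg).tendsto θu).mono_left
      nhdsWithin_le_nhds
  refine le_of_tendsto hc ?_
  filter_upwards [Ioo_mem_nhdsLT h.decay_pos] with η hη
  exact h.cgf_neg_le_zero_of_lt hη.1.le hη.2

lemma convexOn_cgf_step (h : IsReflectedWalk μ X q θu) : ConvexOn ℝ Set.univ (cgf (X 0) μ) :=
  convexOn_cgf (h.measurable_step 0) convex_univ fun η _ => h.integrable_exp η

/-- A convex function that vanishes at 0 and is nonpositive at `-θu` is nonnegative to the right of
0. -/
lemma cgf_nonneg (h : IsReflectedWalk μ X q θu) {η : ℝ} (hη : 0 ≤ η) : 0 ≤ cgf (X 0) μ η := by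
  rcases hη.eq_or_lt with rfl | hη
  · simp
  have hu := h.decay_pos
  have h1 := h.convexOn_cgf_step.2 (Set.mem_univ (-θu)) (Set.mem_univ η)
    (show 0 ≤ η / (η + θu) by positivity) (show 0 ≤ θu / (η + θu) by positivity) (by field_simp)
  have h2 : (η / (η + θu)) • (-θu) + (θu / (η + θu)) • η = 0 := by
    simp only [smul_eq_mul]; ring
  rw [h2, cgf_zero, smul_eq_mul, smul_eq_mul] at h1
  have h3 := mul_nonpos_of_nonneg_of_nonpos (show 0 ≤ η / (η + θu) by positivity) h.cgf_neg_le_zero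
  exact nonneg_of_mul_nonneg_right (by linarith) (show 0 < θu / (η + θu) by positivity)

lemma one_le_mgf (h : IsReflectedWalk μ X q θu) {η : ℝ} (hη : 0 ≤ η) : 1 ≤ mgf (X 0) μ η := by
  rw [← exp_cgf (h.integrable_exp η)]
  exact Real.one_le_exp (h.cgf_nonneg hη)

/-- Split θ as η + (θ - η), bounding q 0 - q t by q 0 in the first part and by the sum of steps in
the second; the two bounds are independent. -/
lemma exists_integral_exp_sub_le (h : IsReflectedWalk μ X q θu) {θ η : ℝ} (hη : 0 ≤ η)
    (hηu : η < θu) (hηθ : η ≤ θ) :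
    ∃ K, 0 < K ∧ ∀ t, ∫ ω, Real.exp (θ * (q 0 ω - q t ω)) ∂μ ≤ K * mgf (X 0) μ (θ - η) ^ t := by
  have hi0 := h.decay.integrable_exp_mul (h.measurable 0) h.nonneg_zero hη hηu
  have hpos := integral_exp_pos hi0
  -- The 2 absorbs the slack summand 1 below, because the moment generating function is at least 1
  -- here.
  refine ⟨(∫ ω, Real.exp (η * q 0 ω) ∂μ) * 2, by positivity, fun t => ?_⟩
  have hiY : Integrable (fun ω => 1 + Real.exp ((θ - η) * ∑ n ∈ Finset.range t, X n ω)) μ :=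
    (integrable_const 1).add (h.integrable_exp_sum (θ - η) t)
  have hind := h.indep_zero_comp (f := fun x => Real.exp (η * x))
    (g := fun x => 1 + Real.exp ((θ - η) * ∑ n ∈ Finset.range t, x n)) (by fun_prop) (by fun_prop)
  calc ∫ ω, Real.exp (θ * (q 0 ω - q t ω)) ∂μ
      ≤ ∫ ω, Real.exp (η * q 0 ω) *
          (1 + Real.exp ((θ - η) * ∑ n ∈ Finset.range t, X n ω)) ∂μ := by
        refine integral_mono (h.integrable_exp_sub (hη.trans hηθ) t) (hind.integrable_mul hi0 hiY)
          fun ω => ?_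
        have h1 := h.sub_sum_le t ω
        have h2 := h.nonneg t ω
        have e : θ * (q 0 ω - q t ω) = η * (q 0 ω - q t ω) + (θ - η) * (q 0 ω - q t ω) := by ring
        rw [e, Real.exp_add]
        gcongr
        · linarith
        · refine (Real.exp_le_exp.2 (mul_le_mul_of_nonneg_left
            (show q 0 ω - q t ω ≤ ∑ n ∈ Finset.range t, X n ω by linarith)
            (sub_nonneg.2 hηθ))).trans ?_
          linarith
    _ = (∫ ω, Real.exp (η * q 0 ω) ∂μ) * (1 + mgf (X 0) μ (θ - η) ^ t) := by
        rw [hind.integral_fun_mul_eq_mul_integral hi0.aestronglyMeasurable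
          hiY.aestronglyMeasurable, integral_add (integrable_const 1) (h.integrable_exp_sum _ _),
          h.integral_exp_sum]
        simp
    _ ≤ _ := by
        rw [mul_assoc]
        gcongr
        have := one_le_pow₀ (n := t) (h.one_le_mgf (sub_nonneg.2 hηθ))
        linarith

/-- Drop q 0 ≥ 0 and replace q t by q 0 in law: the lower bound does not depend on `t`. -/
lemma integral_exp_neg_le (h : IsReflectedWalk μ X q θu) {θ : ℝ} (hθ : 0 ≤ θ) (t : ℕ) :
    ∫ ω, Real.exp (-θ * q 0 ω) ∂μ ≤ ∫ ω, Real.exp (θ * (q 0 ω - q t ω)) ∂μ := by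
  have hid := (h.steady t).comp (u := fun x => Real.exp (-θ * x)) (by fun_prop)
  have he : ∫ ω, Real.exp (-θ * q t ω) ∂μ = ∫ ω, Real.exp (-θ * q 0 ω) ∂μ := hid.integral_eq
  rw [← he]
  refine integral_mono_of_nonneg (ae_of_all _ fun _ => (Real.exp_pos _).le)
    (h.integrable_exp_sub hθ t) (ae_of_all _ fun ω => Real.exp_le_exp.2 ?_)
  have := mul_nonneg hθ (h.nonneg 0 ω)
  linarith

end IsReflectedWalk

/-! ### Running maxima, lower bounds and the growth rate -/

/-- The maximum of the first `t` partial sums (including the empty one) of a sequence. -/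
noncomputable def runningMax (t : ℕ) (x : ℕ → ℝ) : ℝ :=
  partialSups (fun s => ∑ n ∈ Finset.range s, x n) t

lemma measurable_runningMax (t : ℕ) : Measurable (runningMax t) := by
  unfold runningMax
  simp_rw [partialSups_eq_sup'_range]
  exact Finset.measurable_range_sup'' fun k _ => by fun_prop

lemma sum_le_runningMax {s t : ℕ} (hst : s ≤ t) (x : ℕ → ℝ) :
    ∑ n ∈ Finset.range s, x n ≤ runningMax t x :=
  le_partialSups_of_le (fun s => ∑ n ∈ Finset.range s, x n) hst

lemma runningMax_nonneg (t : ℕ) (x : ℕ → ℝ) : 0 ≤ runningMax t x := by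
  simpa using sum_le_runningMax t.zero_le x

lemma exp_mul_runningMax_le (η : ℝ) (t : ℕ) (x : ℕ → ℝ) :
    Real.exp (η * runningMax t x) ≤
      ∑ s ∈ Finset.range (t + 1), Real.exp (η * ∑ n ∈ Finset.range s, x n) := by
  obtain ⟨j, hj, he⟩ := exists_partialSups_eq (fun s => ∑ n ∈ Finset.range s, x n) t
  rw [runningMax, he]
  exact Finset.single_le_sum
    (f := fun s => Real.exp (η * ∑ n ∈ Finset.range s, x n))
    (fun _ _ => (Real.exp_pos _).le) (Finset.mem_range.2 (Nat.lt_succ_of_le hj))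

namespace IsReflectedWalk

variable {X q : ℕ → Ω → ℝ} {θu : ℝ}

lemma measurable_runningMax_step (h : IsReflectedWalk μ X q θu) (t : ℕ) :
    Measurable fun ω => runningMax t fun n => X n ω :=
  (measurable_runningMax t).comp (measurable_pi_lambda _ h.measurable_step)

lemma measurable_sum_step (h : IsReflectedWalk μ X q θu) (t : ℕ) :
    Measurable fun ω => ∑ n ∈ Finset.range t, X n ω :=
  Finset.measurable_sum _ fun n _ => h.measurable_step n

variable [IsProbabilityMeasure μ]

lemma integrable_exp_mul_runningMax (h : IsReflectedWalk μ X q θu) (η : ℝ) (t : ℕ) :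
    Integrable (fun ω => Real.exp (η * runningMax t fun n => X n ω)) μ := by
  have hm := h.measurable_runningMax_step t
  refine (integrable_finsetSum (Finset.range (t + 1))
    fun s _ => h.integrable_exp_sum η s).mono'
    (hm.const_mul η).exp.aestronglyMeasurable (ae_of_all _ fun ω => ?_)
  rw [Real.norm_eq_abs, Real.abs_exp]
  exact exp_mul_runningMax_le η t _

/-- Union bound over the t + 1 partial sums; the last moment is the largest since the moment
generating function is at least 1. -/
lemma integral_exp_mul_runningMax_le (h : IsReflectedWalk μ X q θu) {η : ℝ} (hη : 0 ≤ η) (t : ℕ) :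
    ∫ ω, Real.exp (η * runningMax t fun n => X n ω) ∂μ ≤ (t + 1) * mgf (X 0) μ η ^ t :=
  calc _ ≤ ∫ ω, ∑ s ∈ Finset.range (t + 1), Real.exp (η * ∑ n ∈ Finset.range s, X n ω) ∂μ :=
        integral_mono (h.integrable_exp_mul_runningMax η t)
          (integrable_finsetSum _ fun s _ => h.integrable_exp_sum η s)
          fun ω => exp_mul_runningMax_le η t _
    _ = ∑ s ∈ Finset.range (t + 1), mgf (X 0) μ η ^ s := by
        rw [integral_finsetSum _ fun s _ => h.integrable_exp_sum η s]
        simp_rw [h.integral_exp_sum]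
    _ ≤ ∑ _s ∈ Finset.range (t + 1), mgf (X 0) μ η ^ t :=
        Finset.sum_le_sum fun s hs =>
          pow_le_pow_right₀ (h.one_le_mgf hη) (Nat.lt_succ_iff.1 (Finset.mem_range.1 hs))
    _ = _ := by simp

lemma integrable_exp_sum_sub_runningMax (h : IsReflectedWalk μ X q θu) (θ : ℝ) {κ : ℝ}
    (hκ : 0 ≤ κ) (t : ℕ) :
    Integrable (fun ω => Real.exp (θ * ∑ n ∈ Finset.range t, X n ω -
      κ * runningMax t fun n => X n ω)) μ := by
  have hm := h.measurable_runningMax_step t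
  have hs := h.measurable_sum_step t
  refine (h.integrable_exp_sum θ t).mono' (by fun_prop) (ae_of_all _ fun ω => ?_)
  rw [Real.norm_eq_abs, Real.abs_exp, Real.exp_le_exp]
  linarith [mul_nonneg hκ (runningMax_nonneg t fun n => X n ω)]

/-- On the event that the initial value exceeds the running maximum, the walk is not reflected. -/
lemma exists_mul_integral_le (h : IsReflectedWalk μ X q θu) {θ κ : ℝ} (hθ : 0 ≤ θ)
    (hκ : θu < κ) :
    ∃ c, 0 < c ∧ ∀ t, c * ∫ ω, Real.exp (θ * ∑ n ∈ Finset.range t, X n ω -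
      κ * runningMax t fun n => X n ω) ∂μ ≤ ∫ ω, Real.exp (θ * (q 0 ω - q t ω)) ∂μ := by
  obtain ⟨c, hc, htail⟩ := h.decay.exists_le_tail h.decay_pos hκ
  refine ⟨c, hc, fun t => ?_⟩
  have hi := h.integrable_exp_sum_sub_runningMax θ (h.decay_pos.trans hκ).le t
  have hV : Measurable fun ω n => X n ω := measurable_pi_lambda _ h.measurable_step
  let S : Set (ℝ × (ℕ → ℝ)) := {z | runningMax t z.2 ≤ z.1}
  have hS : MeasurableSet S :=
    measurableSet_le ((measurable_runningMax t).comp measurable_snd) measurable_fst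
  let F : ℝ × (ℕ → ℝ) → ENNReal :=
    S.indicator fun z => ENNReal.ofReal (Real.exp (θ * ∑ n ∈ Finset.range t, z.2 n))
  have hF : Measurable F := Measurable.indicator (by fun_prop) hS
  rw [← integral_const_mul,
    ← ENNReal.ofReal_le_ofReal_iff (integral_nonneg fun _ => (Real.exp_pos _).le),
    ofReal_integral_eq_lintegral_ofReal (hi.const_mul c) (ae_of_all _ fun _ => by positivity),
    ofReal_integral_eq_lintegral_ofReal (h.integrable_exp_sub hθ t)
      (ae_of_all _ fun _ => (Real.exp_pos _).le)]
  -- With the steps frozen, the inner integral is exp(θ S_t) times the tail of `q 0` at the running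
  -- maximum.
  calc _ ≤ ∫⁻ ω, ∫⁻ ω', F (q 0 ω', fun n => X n ω) ∂μ ∂μ := by
        refine lintegral_mono fun ω => ?_
        set m := runningMax t fun n => X n ω with hm
        have e : (fun ω' => F (q 0 ω', fun n => X n ω)) = {ω' | m ≤ q 0 ω'}.indicator
            fun _ => ENNReal.ofReal (Real.exp (θ * ∑ n ∈ Finset.range t, X n ω)) := by
          ext ω'
          simp only [F, S, Set.indicator, Set.mem_ofPred_eq, hm]
        rw [e, lintegral_indicator_const (measurableSet_le measurable_const (h.measurable 0)),
          ← ofReal_measureReal, ← ENNReal.ofReal_mul (Real.exp_pos _).le]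
        refine ENNReal.ofReal_le_ofReal ?_
        calc _ = Real.exp (θ * ∑ n ∈ Finset.range t, X n ω) * (c * Real.exp (-κ * m)) := by
              rw [sub_eq_add_neg, Real.exp_add, neg_mul]; ring
          _ ≤ _ := by
              gcongr
              exact htail m (runningMax_nonneg t _)
    _ = ∫⁻ ω, F (q 0 ω, fun n => X n ω) ∂μ :=
        (lintegral_comp_prodMk_of_indepFun (h.measurable 0) hV h.indep_zero hF).symm
    _ ≤ _ := by
        refine lintegral_mono fun ω => Set.indicator_apply_le' (fun hω => ?_) fun _ => zero_le
        have := h.eq_sub_sum t ω fun s hs => (sum_le_runningMax hs _).trans hω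
        rw [this, sub_sub_cancel]

/-- Take κ = θ - η > θu. Hölder bounds E exp(η S_t) by powers of A = E exp(θ S_t - κ M_t) and E
exp(η M_t); as the latter is at most (t + 1) E exp(η S_t), solving for A loses only a power of t +
1. -/
lemma exists_le_log_integral_exp_sub (h : IsReflectedWalk μ X q θu) {θ η : ℝ} (hη : 0 < η)
    (hηθ : η < θ - θu) :
    ∃ C, ∀ t : ℕ, C + t * cgf (X 0) μ η - (θ - η) / η * Real.log (t + 1) ≤
      Real.log (∫ ω, Real.exp (θ * (q 0 ω - q t ω)) ∂μ) := by
  have hu := h.decay_pos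
  have hθ : 0 < θ := by linarith
  have hκ : 0 < θ - η := by linarith
  obtain ⟨c, hc, hle⟩ := h.exists_mul_integral_le (κ := θ - η) hθ.le (by linarith)
  refine ⟨Real.log c, fun t => ?_⟩
  have hA := h.integrable_exp_sum_sub_runningMax θ hκ.le t
  have hB := h.integrable_exp_mul_runningMax η t
  have hm := h.measurable_runningMax_step t
  have hs := h.measurable_sum_step t
  -- The weights η/θ and (θ - η)/θ are those for which the running maximum cancels, leaving η S_t.
  have hol := log_integral_exp_convex_comb_le (μ := μ)
    (by fun_prop) (by fun_prop) hA hB (p := η / θ) (q := (θ - η) / θ)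
    (by positivity) (by positivity) (by field_simp; ring)
  have e : ∀ ω, η / θ * (θ * ∑ n ∈ Finset.range t, X n ω -
      (θ - η) * runningMax t fun n => X n ω) + (θ - η) / θ * (η * runningMax t fun n => X n ω) =
      η * ∑ n ∈ Finset.range t, X n ω := fun ω => by field_simp; ring
  simp_rw [e] at hol
  have hφ := mgf_pos (h.integrable_exp η)
  have hBle := Real.log_le_log (integral_exp_pos hB) (h.integral_exp_mul_runningMax_le hη.le t)
  have hFle := Real.log_le_log (mul_pos hc (integral_exp_pos hA)) (hle t)
  rw [Real.log_mul hc.ne' (integral_exp_pos hA).ne'] at hFle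
  rw [Real.log_mul (by positivity) (by positivity), Real.log_pow] at hBle
  rw [h.integral_exp_sum, Real.log_pow] at hol
  change t * cgf (X 0) μ η ≤ _ at hol
  change _ ≤ _ + t * cgf (X 0) μ η at hBle
  refine le_trans ?_ hFle
  have h1 := mul_le_mul_of_nonneg_left hBle (show 0 ≤ (θ - η) / η by positivity)
  have h2 := mul_le_mul_of_nonneg_left hol (show 0 ≤ θ / η by positivity)
  rw [mul_add, ← mul_assoc (θ / η) (η / θ), ← mul_assoc (θ / η) ((θ - η) / θ),
    show θ / η * (η / θ) = 1 by field_simp, show θ / η * ((θ - η) / θ) = (θ - η) / η by field_simp,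
    show θ / η = 1 + (θ - η) / η by field_simp; ring] at h2
  linarith

/-- The exponential growth rate of the moments of the increments of a reflected walk. -/
theorem tendsto_log_integral_exp_sub (h : IsReflectedWalk μ X q θu) {θ : ℝ} (hθ : 0 < θ) :
    Tendsto (fun t : ℕ => Real.log (∫ ω, Real.exp (θ * (q 0 ω - q t ω)) ∂μ) / t) atTop
      (𝓝 (cgf (X 0) μ (max (θ - θu) 0))) := by
  have hu := h.decay_pos
  have hcont := continuous_cgf h.integrable_exp
  have hpos : ∀ t, 0 < ∫ ω, Real.exp (θ * (q 0 ω - q t ω)) ∂μ := fun t =>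
    integral_exp_pos (h.integrable_exp_sub hθ.le t)
  have hdiv : ∀ C : ℝ, Tendsto (fun t : ℕ => C / (t : ℝ)) atTop (𝓝 0) :=
    tendsto_const_div_atTop_nhds_zero_nat
  refine tendsto_order.2 ⟨fun a ha => ?_, fun b hb => ?_⟩
  · rcases le_or_gt θ θu with hle | hlt
    · rw [max_eq_right (by linarith), cgf_zero] at ha
      filter_upwards [(hdiv (Real.log (∫ ω, Real.exp (-θ * q 0 ω) ∂μ))).eventually_const_lt ha]
        with t ht
      refine ht.trans_le ?_
      have hi : Integrable (fun ω => Real.exp (-θ * q 0 ω)) μ := by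
        have h0 := h.measurable 0
        refine (integrable_const (1 : ℝ)).mono' (by fun_prop) (ae_of_all _ fun ω => ?_)
        rw [Real.norm_eq_abs, Real.abs_exp, Real.exp_le_one_iff]
        nlinarith [h.nonneg_zero ω]
      exact div_le_div_of_nonneg_right
        (Real.log_le_log (integral_exp_pos hi) (h.integral_exp_neg_le hθ.le t)) t.cast_nonneg
    · rw [max_eq_left (by linarith)] at ha
      have hd : 0 < θ - θu := by linarith
      have hev : ∀ᶠ η in 𝓝[<] (θ - θu), a < cgf (X 0) μ η :=
        ((hcont.tendsto _).mono_left nhdsWithin_le_nhds).eventually_const_lt ha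
      obtain ⟨η, hηa, hη0, hη1⟩ := (hev.and (Ioo_mem_nhdsLT hd)).exists
      obtain ⟨C, hC⟩ := h.exists_le_log_integral_exp_sub hη0 hη1
      have hlog : Tendsto (fun t : ℕ => Real.log (t + 1) / t) atTop (𝓝 0) := by
        -- This is log x / (x - 1) → 0 evaluated at x = t + 1.
        have := (Real.tendsto_pow_log_div_mul_add_atTop 1 (-1) 1 one_ne_zero).comp
          (tendsto_atTop_add_const_right atTop (1 : ℝ) tendsto_natCast_atTop_atTop)
        simpa [Function.comp_def] using this
      have hlim : Tendsto (fun t : ℕ => C / t + cgf (X 0) μ η -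
          (θ - η) / η * (Real.log (t + 1) / t)) atTop (𝓝 (cgf (X 0) μ η)) := by
        simpa using ((hdiv C).add_const (cgf (X 0) μ η)).sub (hlog.const_mul ((θ - η) / η))
      filter_upwards [hlim.eventually_const_lt hηa, eventually_gt_atTop 0] with t ht ht0
      refine ht.trans_le ?_
      have ht0' : (0 : ℝ) < t := Nat.cast_pos.2 ht0
      rw [le_div_iff₀ ht0']
      refine le_trans (le_of_eq ?_) (hC t)
      field_simp
  · set m := max (θ - θu) 0 with hm
    have hev : ∀ᶠ δ in 𝓝[>] (0 : ℝ), cgf (X 0) μ (m + δ) < b := by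
      have : Tendsto (fun δ => cgf (X 0) μ (m + δ)) (𝓝 0) (𝓝 (cgf (X 0) μ m)) := by
        have := (hcont.comp (continuous_const_add m)).tendsto 0
        simpa [Function.comp_def] using this
      exact (this.mono_left nhdsWithin_le_nhds).eventually_lt_const hb
    obtain ⟨δ, hδb, hδ0, hδ1⟩ := (hev.and (Ioo_mem_nhdsGT (lt_min hθ hu))).exists
    -- The exponent spent on `q 0` is δ below min(θ, θu), so the steps carry δ more than the
    -- limiting exponent.
    have hmδ : θ - (min θ θu - δ) = m + δ := by
      rcases le_total θ θu with hle | hle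
      · rw [hm, min_eq_left hle, max_eq_right (by linarith)]; ring
      · rw [hm, min_eq_right hle, max_eq_left (by linarith)]; ring
    obtain ⟨K, hK, hle⟩ := h.exists_integral_exp_sub_le (θ := θ) (η := min θ θu - δ)
      (by linarith) (by linarith [min_le_right θ θu]) (by linarith [min_le_left θ θu])
    rw [hmδ] at hle
    have hlim : Tendsto (fun t : ℕ => Real.log K / t + cgf (X 0) μ (m + δ)) atTop
        (𝓝 (cgf (X 0) μ (m + δ))) := by
      simpa using (hdiv (Real.log K)).add_const (cgf (X 0) μ (m + δ))
    filter_upwards [hlim.eventually_lt_const hδb, eventually_gt_atTop 0] with t ht ht0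
    refine lt_of_le_of_lt ?_ ht
    have ht0' : (0 : ℝ) < t := Nat.cast_pos.2 ht0
    have hφ := mgf_pos (h.integrable_exp (m + δ))
    rw [div_le_iff₀ ht0']
    refine (Real.log_le_log (hpos t) (hle t)).trans (le_of_eq ?_)
    rw [Real.log_mul hK.ne' (by positivity), Real.log_pow, cgf]
    field_simp

end IsReflectedWalk

/-! ### Queues and effective bandwidths; the downlink inequality -/

lemma IsSteadyQueue.sum_sub_sum_le {a r q : ℕ → Ω → ℝ} (h : IsSteadyQueue μ a r q) (t : ℕ)
    (ω : Ω) : ∑ n ∈ Finset.range t, a n ω - ∑ n ∈ Finset.range t, r n ω ≤ q t ω := by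
  induction t with
  | zero => simpa using h.nonneg_zero ω
  | succ t ih =>
    rw [Finset.sum_range_succ, Finset.sum_range_succ, h.step]
    exact le_trans (by linarith) (le_max_left _ _)

lemma sum_departures {S : Type*} (lam : ℝ) (q : ℕ → S → ℝ) (t : ℕ) (ω : S) :
    ∑ n ∈ Finset.range t, departures (fun _ _ => lam) q n ω = t * lam + (q 0 ω - q t ω) := by
  induction t with
  | zero => simp
  | succ t ih =>
    rw [Finset.sum_range_succ, ih, departures]
    push_cast
    ring

lemma HasEffectiveBandwidth.const_mul {a : ℕ → Ω → ℝ} {θ c α : ℝ} (hc : c ≠ 0)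
    (h : HasEffectiveBandwidth μ a (c * θ) α) :
    HasEffectiveBandwidth μ (fun n ω => c * a n ω) θ (c * α) := by
  have e : ∀ (t : ℕ) ω, θ * ∑ n ∈ Finset.range t, c * a n ω =
      c * θ * ∑ n ∈ Finset.range t, a n ω := fun t ω => by rw [← Finset.mul_sum]; ring
  simp only [HasEffectiveBandwidth, e]
  refine ⟨h.1, (h.2.const_mul c).congr fun t => ?_⟩
  rw [← mul_assoc]
  congr 1
  rw [mul_assoc, one_div, one_div, mul_inv, ← mul_assoc, mul_inv_cancel₀ hc, one_mul]

/-- Negative exponents suffice: `-θd` is interior to the domain of the cumulant generating function,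
which is analytic there. -/
lemma continuousAt_effectiveCapacity {R : Ω → ℝ} {θd : ℝ}
    (hR : ∀ η < 0, Integrable (fun ω => Real.exp (η * R ω)) μ) (hθd : 0 < θd) :
    ContinuousAt (effectiveCapacity μ R) θd := by
  have hint : -θd ∈ interior (integrableExpSet R μ) :=
    interior_mono (show Set.Iio 0 ⊆ integrableExpSet R μ from fun η hη => hR η hη)
      (by rw [interior_Iio]; exact neg_lt_zero.2 hθd)
  have hc : ContinuousAt (fun θ => cgf R μ (-θ)) θd :=
    ContinuousAt.comp (f := fun θ : ℝ => -θ) (analyticAt_cgf hint).continuousAt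
      continuous_neg.continuousAt
  exact (continuousAt_const.div continuousAt_id hθd.ne').neg.mul hc

section Downlink

variable [IsProbabilityMeasure μ] {a r q : ℕ → Ω → ℝ} {θd : ℝ}

/-- Below `θd` the moment E exp(θ q t) is finite and constant in t, and it dominates the product of
the arrival and service moments. Take logarithms, divide by θ t and let t → ∞. -/
lemma IsSteadyQueue.effectiveBandwidth_le_of_lt (h : IsSteadyQueue μ a r q)
    (hr : ∀ n, Measurable (r n)) (hrind : iIndepFun r μ)
    (hrid : ∀ n, IdentDistrib (r n) (r 0) μ μ)
    (hri : ∀ η < 0, Integrable (fun ω => Real.exp (η * r 0 ω)) μ)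
    (har : IndepFun (fun ω n => a n ω) (fun ω n => r n ω) μ)
    (hdecay : HasDecayRate μ (q 0) θd) {θ α : ℝ} (hθ : 0 < θ) (hθd : θ < θd)
    (hα : HasEffectiveBandwidth μ a θ α) : α ≤ effectiveCapacity μ (r 0) θ := by
  have hi0 := hdecay.integrable_exp_mul (h.measurable 0) h.nonneg_zero hθ.le hθd
  have hφ := mgf_pos (hri (-θ) (neg_lt_zero.2 hθ))
  set K := ∫ ω, Real.exp (θ * q 0 ω) ∂μ with hK
  have key : ∀ t : ℕ, Real.log (∫ ω, Real.exp (θ * ∑ n ∈ Finset.range t, a n ω) ∂μ) +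
      t * cgf (r 0) μ (-θ) ≤ Real.log K := fun t => by
    have hid := (h.steady t).comp (u := fun x => Real.exp (θ * x)) (by fun_prop)
    have hit : Integrable (fun ω => Real.exp (θ * q t ω)) μ := hid.integrable_iff.2 hi0
    have he : ∫ ω, Real.exp (θ * q t ω) ∂μ = K := hid.integral_eq
    have hir := integrable_exp_mul_sum_of_identDistrib hr hrind hrid
      (hri (-θ) (neg_lt_zero.2 hθ)) t
    have hind : IndepFun (fun ω => Real.exp (θ * ∑ n ∈ Finset.range t, a n ω))
        (fun ω => Real.exp (-θ * ∑ n ∈ Finset.range t, r n ω)) μ :=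
      har.comp (φ := fun x : ℕ → ℝ => Real.exp (θ * ∑ n ∈ Finset.range t, x n))
        (ψ := fun x : ℕ → ℝ => Real.exp (-θ * ∑ n ∈ Finset.range t, x n)) (by fun_prop) (by fun_prop)
    have hA := integral_exp_pos (hα.1 t)
    have hle : (∫ ω, Real.exp (θ * ∑ n ∈ Finset.range t, a n ω) ∂μ) * mgf (r 0) μ (-θ) ^ t ≤ K := by
      rw [← integral_exp_mul_sum_of_identDistrib hr hrind hrid,
        ← hind.integral_fun_mul_eq_mul_integral (hα.1 t).aestronglyMeasurable
          hir.aestronglyMeasurable, ← he]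
      refine integral_mono (hind.integrable_mul (hα.1 t) hir) hit fun ω => ?_
      simp only [← Real.exp_add, Real.exp_le_exp]
      have := mul_le_mul_of_nonneg_left (h.sum_sub_sum_le t ω) hθ.le
      linarith
    have := Real.log_le_log (by positivity) hle
    rwa [Real.log_mul hA.ne' (by positivity), Real.log_pow] at this
  have hlim : Tendsto (fun t : ℕ => Real.log K / θ / t + effectiveCapacity μ (r 0) θ) atTop
      (𝓝 (effectiveCapacity μ (r 0) θ)) := by
    simpa using (tendsto_const_div_atTop_nhds_zero_nat (Real.log K / θ)).add_const
      (effectiveCapacity μ (r 0) θ)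
  refine le_of_tendsto_of_tendsto hα.2 hlim ?_
  filter_upwards [eventually_gt_atTop 0] with t ht
  have ht' : (0 : ℝ) < t := Nat.cast_pos.2 ht
  have e : effectiveCapacity μ (r 0) θ = -(1 / θ) * cgf (r 0) μ (-θ) := rfl
  rw [e]
  have := mul_le_mul_of_nonneg_left (key t) (show 0 ≤ 1 / (θ * t) by positivity)
  calc _ ≤ 1 / (θ * t) * Real.log K - 1 / (θ * t) * (t * cgf (r 0) μ (-θ)) := by linarith
    _ = _ := by field_simp; ring

/-- A pointwise limit of the convex functions θ ↦ log E exp(θ A_t) / t, with A_t the cumulative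
arrivals. Convexity on a ball then yields continuity at its centre. -/
lemma convexOn_mul_effectiveBandwidth (ha : ∀ n, Measurable (a n)) {s : Set ℝ}
    (hs : Convex ℝ s) (hs0 : ∀ θ ∈ s, 0 < θ) {lam : ℝ → ℝ}
    (h : ∀ θ ∈ s, HasEffectiveBandwidth μ a θ (lam θ)) :
    ConvexOn ℝ s fun θ => θ * lam θ := by
  have hm : ∀ t : ℕ, Measurable fun ω => ∑ n ∈ Finset.range t, a n ω := fun t =>
    Finset.measurable_sum _ fun n _ => ha n
  have hlim : ∀ θ ∈ s, Tendsto (fun t : ℕ =>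
      cgf (fun ω => ∑ n ∈ Finset.range t, a n ω) μ θ / t) atTop (𝓝 (θ * lam θ)) := fun θ hθ => by
    have hθ0 := hs0 θ hθ
    refine ((h θ hθ).2.const_mul θ).congr fun t => ?_
    rw [cgf, mgf, ← mul_assoc, one_div, mul_inv, ← mul_assoc, mul_inv_cancel₀ hθ0.ne', one_mul,
      inv_mul_eq_div]
  refine ⟨hs, fun x hx y hy p q hp hq hpq => ?_⟩
  refine le_of_tendsto_of_tendsto' (hlim _ (hs hx hy hp hq hpq))
    (((hlim x hx).const_mul p).add ((hlim y hy).const_mul q)) fun t => ?_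
  have hc := (convexOn_cgf (hm t) hs fun θ hθ => (h θ hθ).1 t).2 hx hy hp hq hpq
  simp only [smul_eq_mul] at hc ⊢
  rw [← mul_div_assoc, ← mul_div_assoc, ← add_div]
  exact div_le_div_of_nonneg_right hc t.cast_nonneg

lemma continuousAt_effectiveBandwidth (ha : ∀ n, Measurable (a n)) (hθd : 0 < θd) {lam : ℝ → ℝ}
    (h : ∀ᶠ θ in 𝓝 θd, HasEffectiveBandwidth μ a θ (lam θ)) : ContinuousAt lam θd := by
  obtain ⟨ε, hε, hball⟩ := Metric.eventually_nhds_iff_ball.1 (h.and (lt_mem_nhds hθd))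
  have hc := (convexOn_mul_effectiveBandwidth ha (convex_ball θd ε) (fun θ hθ => (hball θ hθ).2)
    fun θ hθ => (hball θ hθ).1).continuousOn Metric.isOpen_ball
  have hc' := (hc.continuousAt (Metric.ball_mem_nhds θd hε)).div continuousAt_id hθd.ne'
  refine hc'.congr ?_
  filter_upwards [lt_mem_nhds hθd] with θ hθ
  exact mul_div_cancel_left₀ _ hθ.ne'

/-- The effective bandwidth of the arrivals is at most the effective capacity of the service,
at the decay rate of the backlog. -/
theorem IsSteadyQueue.effectiveBandwidth_le (h : IsSteadyQueue μ a r q)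
    (ha : ∀ n, Measurable (a n)) (hr : ∀ n, Measurable (r n)) (hrind : iIndepFun r μ)
    (hrid : ∀ n, IdentDistrib (r n) (r 0) μ μ)
    (hri : ∀ η < 0, Integrable (fun ω => Real.exp (η * r 0 ω)) μ)
    (har : IndepFun (fun ω n => a n ω) (fun ω n => r n ω) μ)
    (hdecay : HasDecayRate μ (q 0) θd) (hθd : 0 < θd) {lam : ℝ → ℝ}
    (hlam : ∀ᶠ θ in 𝓝 θd, HasEffectiveBandwidth μ a θ (lam θ)) :
    lam θd ≤ effectiveCapacity μ (r 0) θd := by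
  refine le_of_tendsto_of_tendsto
    ((continuousAt_effectiveBandwidth ha hθd hlam).tendsto.mono_left
      (nhdsWithin_le_nhds (s := Set.Iio θd)))
    ((continuousAt_effectiveCapacity hri hθd).tendsto.mono_left nhdsWithin_le_nhds) ?_
  filter_upwards [nhdsWithin_le_nhds hlam, Ioo_mem_nhdsLT hθd] with θ hθ hθ'
  exact h.effectiveBandwidth_le_of_lt hr hrind hrid hri har hdecay hθ'.1 hθ'.2 hθ

end Downlink

/-! ### The finite-blocklength service process -/

section Service

variable {W L e : ℝ} {snr : ℕ → Ω → ℝ}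

lemma measurable_rate (W L e : ℝ) : Measurable (rate W L e) := by
  unfold rate dispersion Real.logb
  fun_prop

lemma exists_neg_le_rate (hW : 0 ≤ W) (hL : 0 ≤ L) (e : ℝ) :
    ∃ B, ∀ s, 0 ≤ s → -B ≤ rate W L e s := by
  refine ⟨Real.sqrt (1 / L) * |gaussianQInv e|, fun s hs => ?_⟩
  have h1 : 0 ≤ W * Real.logb 2 (1 + s) :=
    mul_nonneg hW (Real.logb_nonneg one_lt_two (by linarith))
  have h2 : Real.sqrt (dispersion s / L) * gaussianQInv e ≤
      Real.sqrt (1 / L) * |gaussianQInv e| := by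
    refine (mul_le_mul_of_nonneg_left (le_abs_self _) (Real.sqrt_nonneg _)).trans ?_
    gcongr
    rw [dispersion]
    have : 0 ≤ 1 / (1 + s) ^ 2 := by positivity
    linarith
  rw [rate]
  linarith

lemma IsChannel.measurable_service (h : IsChannel μ snr) (n : ℕ) :
    Measurable (service W L e snr n) :=
  (measurable_rate W L e).comp (h.measurable n)

lemma IsChannel.iIndepFun_service (h : IsChannel μ snr) : iIndepFun (service W L e snr) μ :=
  h.indep.comp (fun _ => rate W L e) fun _ => measurable_rate W L e

lemma IsChannel.identDistrib_service (h : IsChannel μ snr) (n : ℕ) :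
    IdentDistrib (service W L e snr n) (service W L e snr 0) μ μ :=
  (h.identDistrib n).comp (measurable_rate W L e)

lemma measurable_rate_seq (W L e : ℝ) :
    Measurable fun (x : ℕ → ℝ) n => rate W L e (x n) :=
  measurable_pi_lambda _ fun n => (measurable_rate W L e).comp (measurable_pi_apply n)

/-- The rate is bounded below, since the logarithm is nonnegative and the dispersion at most 1; so
no moment assumption is needed for negative exponents. -/
lemma IsChannel.integrable_exp_mul_service [IsProbabilityMeasure μ] (h : IsChannel μ snr)
    (hW : 0 ≤ W) (hL : 0 ≤ L) {η : ℝ} (hη : η < 0) :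
    Integrable (fun ω => Real.exp (η * service W L e snr 0 ω)) μ := by
  obtain ⟨B, hB⟩ := exists_neg_le_rate hW hL e
  have := integrable_exp_mul_of_le (μ := μ) (X := fun ω => -service W L e snr 0 ω) (-η) B
    (by linarith) (h.measurable_service 0).neg.aemeasurable
    (ae_of_all _ fun ω => neg_le.1 (hB _ (h.nonneg 0 ω)))
  simpa using this

end Service

/-! ### The uplink queue and its departure rate -/

section Uplink

variable {W L e lam θu : ℝ} {snr q : ℕ → Ω → ℝ}

lemma IsSteadyQueue.isReflectedWalk (hsnr : IsChannel μ snr)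
    (hmom : ∀ η : ℝ, Integrable (fun ω => Real.exp (η * service W L e snr 0 ω)) μ)
    (hq : IsSteadyQueue μ (fun _ _ => lam) (service W L e snr) q)
    (hind : IndepFun (q 0) (fun ω n => snr n ω) μ)
    (hdecay : HasDecayRate μ (q 0) θu) (hθu : 0 < θu) :
    IsReflectedWalk μ (fun n ω => service W L e snr n ω - lam) q θu where
  measurable_step n := (hsnr.measurable_service n).sub_const lam
  indep_step := hsnr.iIndepFun_service.comp (fun _ x => x - lam) fun _ => by fun_prop
  ident_step n := (hsnr.identDistrib_service n).comp (u := fun x => x - lam) (by fun_prop)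
  integrable_exp η := by
    refine ((hmom η).mul_const (Real.exp (-η * lam))).congr (ae_of_all _ fun ω => ?_)
    simp only [← Real.exp_add]
    ring_nf
  measurable := hq.measurable
  nonneg_zero := hq.nonneg_zero
  step n ω := by rw [hq.step]; ring_nf
  steady := hq.steady
  indep_zero := hind.comp measurable_id
    (ψ := fun (x : ℕ → ℝ) n => rate W L e (x n) - lam)
    (measurable_pi_lambda _ fun n =>
      ((measurable_rate W L e).comp (measurable_pi_apply n)).sub_const lam)
  decay := hdecay
  decay_pos := hθu

variable [IsProbabilityMeasure μ]

lemma cgf_sub_const {R : Ω → ℝ} {η : ℝ} (hi : Integrable (fun ω => Real.exp (η * R ω)) μ)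
    (lam : ℝ) : cgf (fun ω => R ω - lam) μ η = cgf R μ η - η * lam := by
  simp_rw [sub_eq_add_neg]
  rw [cgf, mgf_add_const, Real.log_mul (mgf_pos hi).ne' (Real.exp_pos _).ne', Real.log_exp, cgf]
  ring

/-- Centring the service by `lam` merges the two cases, because a cumulant generating function
vanishes at 0. -/
lemma departureRate_eq {R : Ω → ℝ} (hmom : ∀ η : ℝ, Integrable (fun ω => Real.exp (η * R ω)) μ)
    (lam θu : ℝ) {θ : ℝ} (hθ : 0 < θ) :
    departureRate lam (effectiveCapacity μ R) θu θ =
      lam + cgf (fun ω => R ω - lam) μ (max (θ - θu) 0) / θ := by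
  rw [departureRate]
  split_ifs with h
  · rw [max_eq_right (by linarith), cgf_zero]
    simp
  · push Not at h
    have hd : 0 < θ - θu := by linarith
    have e : effectiveCapacity μ R (θu - θ) = 1 / (θ - θu) * cgf R μ (θ - θu) := by
      rw [effectiveCapacity, neg_sub, cgf, mgf, ← neg_sub θ θu, one_div_neg_eq_neg_one_div, neg_neg]
    rw [max_eq_left hd.le, cgf_sub_const (hmom _), e]
    field_simp
    ring

lemma IsReflectedWalk.hasEffectiveBandwidth_departures {R : ℕ → Ω → ℝ}
    (h : IsReflectedWalk μ (fun n ω => R n ω - lam) q θu)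
    (hmom : ∀ η : ℝ, Integrable (fun ω => Real.exp (η * R 0 ω)) μ) {θ : ℝ} (hθ : 0 < θ) :
    HasEffectiveBandwidth μ (departures (fun _ _ => lam) q) θ
      (departureRate lam (effectiveCapacity μ (R 0)) θu θ) := by
  have e : ∀ (t : ℕ) ω, Real.exp (θ * ∑ n ∈ Finset.range t, departures (fun _ _ => lam) q n ω) =
      Real.exp (θ * (t * lam)) * Real.exp (θ * (q 0 ω - q t ω)) := fun t ω => by
    rw [sum_departures, ← Real.exp_add, mul_add]
  have hi := fun t => h.integrable_exp_sub hθ.le t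
  simp only [HasEffectiveBandwidth, e]
  refine ⟨fun t => (hi t).const_mul _, ?_⟩
  rw [departureRate_eq hmom lam θu hθ]
  refine (((h.tendsto_log_integral_exp_sub hθ).div_const θ).const_add lam).congr' ?_
  filter_upwards [eventually_gt_atTop 0] with t ht
  have ht' : (0 : ℝ) < t := Nat.cast_pos.2 ht
  rw [integral_const_mul, Real.log_mul (Real.exp_pos _).ne' (integral_exp_pos (hi t)).ne',
    Real.log_exp]
  field_simp

/-- Above `θu`, convexity and Λ(0) = 0 make Λ(s)/s nondecreasing in s = θ - θu; the remaining factor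
(θ - θu)/θ also increases, and Λ ≥ 0. Below `θu` the quotient is 0. -/
lemma IsReflectedWalk.cgf_div_monotone {X : ℕ → Ω → ℝ} (h : IsReflectedWalk μ X q θu)
    {θ θ' : ℝ} (hθ : 0 < θ) (hle : θ ≤ θ') :
    cgf (X 0) μ (max (θ - θu) 0) / θ ≤ cgf (X 0) μ (max (θ' - θu) 0) / θ' := by
  have hθ' := hθ.trans_le hle
  have hu := h.decay_pos
  rcases le_or_gt θ θu with hθu | hθu
  · rw [max_eq_right (by linarith : θ - θu ≤ 0), cgf_zero, zero_div]
    exact div_nonneg (h.cgf_nonneg (le_max_right _ _)) hθ'.le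
  · have hd : 0 < θ - θu := by linarith
    have hd' : 0 < θ' - θu := by linarith
    rw [max_eq_left hd.le, max_eq_left hd'.le]
    have hc := h.convexOn_cgf_step.2 (Set.mem_univ (θ' - θu)) (Set.mem_univ 0)
      (show 0 ≤ (θ - θu) / (θ' - θu) by positivity)
      (show 0 ≤ (θ' - θ) / (θ' - θu) from div_nonneg (by linarith) hd'.le) (by field_simp; ring)
    simp only [smul_eq_mul, mul_zero, add_zero, cgf_zero, div_mul_cancel₀ _ hd'.ne'] at hc
    rw [div_le_iff₀ hθ]
    refine hc.trans ?_
    have h1 : (θ - θu) / (θ' - θu) ≤ θ / θ' := by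
      rw [div_le_div_iff₀ hd' hθ']
      nlinarith
    refine (mul_le_mul_of_nonneg_right h1 (h.cgf_nonneg hd'.le)).trans (le_of_eq ?_)
    ring

end Uplink

end TandemQueue

/-! ### The tandem of uplink and downlink -/

open TandemQueue in
theorem theorem2 {Ω : Type*} [MeasurableSpace Ω] (μ : Measure Ω) [IsProbabilityMeasure μ]
    -- sensing and control parameters
    (β γ Ts : ℝ) (ks N : ℕ) (hβ : 0 < β) (hγ : 0 < γ) (hTs : 0 < Ts) (hks : 0 < ks) (hN : 0 < N)
    -- the two channels and the two decay rates
    (Wu Lu eu Wd Ld ed θu θd : ℝ)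
    (hWu : 0 < Wu) (hLu : 0 < Lu) (heu : eu ∈ Set.Ioo (0 : ℝ) 1)
    (hWd : 0 < Wd) (hLd : 0 < Ld) (hed : ed ∈ Set.Ioo (0 : ℝ) 1)
    (hθu : 0 < θu) (hθd : 0 < θd)
    (snru snrd : ℕ → Ω → ℝ) (hsnru : IsChannel μ snru) (hsnrd : IsChannel μ snrd)
    (hmom : ∀ η : ℝ, Integrable (fun ω => Real.exp (η * service Wu Lu eu snru 0 ω)) μ)
    -- the uplink queue, with arrival rate `lamu` and decay rate `θu`
    (lamu : ℝ) (hlamu : lamu = β * ks / Ts)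
    (qu : ℕ → Ω → ℝ)
    (hqu : IsSteadyQueue μ (fun _ _ => lamu) (service Wu Lu eu snru) qu)
    (hqu_indep : IndepFun (qu 0) (fun ω n => snru n ω) μ)
    (hqu_decay : HasDecayRate μ (qu 0) θu)
    -- the uplink departure process
    (du : ℕ → Ω → ℝ) (hdu : du = departures (fun _ _ => lamu) qu)
    -- effective capacities and data conversion factor
    (Cu Cd : ℝ → ℝ)
    (hCu : Cu = effectiveCapacity μ (service Wu Lu eu snru 0))
    (hCd : Cd = effectiveCapacity μ (service Wd Ld ed snrd 0))
    (c : ℝ) (hc : c = N * γ / (β * ks)) :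
    -- uplink inequality
    lamu ≤ Cu θu ∧
    -- the effective bandwidth of the uplink departure process
    HasEffectiveBandwidth μ du θd (departureRate lamu Cu θu θd) ∧
    -- downlink inequality, for every downlink queue with decay rate `θd`
    ∀ (ad qd : ℕ → Ω → ℝ), (∀ n, Measurable (ad n)) →
      IndepFun (fun ω n => ad n ω) (fun ω n => snrd n ω) μ →
      IsSteadyQueue μ ad (service Wd Ld ed snrd) qd →
      HasDecayRate μ (qd 0) θd →
      -- the arrival rate at exponent `θd` is `c` times the uplink departure rate
      ((∀ (lamd : ℝ → ℝ) (L : ℝ),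
          (∀ᶠ θ in 𝓝 θd, HasEffectiveBandwidth μ ad θ (lamd θ)) →
          HasEffectiveBandwidth μ du θd L → lamd θd = c * L →
          lamd θd ≤ Cd θd ∧ c * departureRate lamu Cu θu θd ≤ Cd θd) ∧
      -- the arrivals are, slot by slot, `c` times the uplink departures
        (ad = (fun n ω => c * du n ω) →
          c * departureRate lamu Cu θu (c * θd) ≤ Cd θd ∧
          (1 ≤ c ∨ θd ≤ θu → c * departureRate lamu Cu θu θd ≤ Cd θd))) := by
  have hks' : (0 : ℝ) < ks := Nat.cast_pos.2 hks
  have hN' : (0 : ℝ) < N := Nat.cast_pos.2 hN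
  have hc0 : 0 < c := by rw [hc]; positivity
  have hwalk := IsSteadyQueue.isReflectedWalk hsnru hmom hqu hqu_indep hqu_decay hθu
  have hbw : ∀ θ, 0 < θ → HasEffectiveBandwidth μ du θ (departureRate lamu Cu θu θ) :=
    fun θ hθ => by
      rw [hdu, hCu]
      exact hwalk.hasEffectiveBandwidth_departures hmom hθ
  have hmono : ∀ θ θ', 0 < θ → θ ≤ θ' →
      departureRate lamu Cu θu θ ≤ departureRate lamu Cu θu θ' := fun θ θ' hθ hle => by
    rw [hCu, departureRate_eq hmom _ _ hθ, departureRate_eq hmom _ _ (hθ.trans_le hle)]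
    exact add_le_add_right (hwalk.cgf_div_monotone hθ hle) lamu
  refine ⟨?_, hbw θd hθd, fun ad qd had hind hqd hdecay => ?_⟩
  · have h1 := hwalk.cgf_neg_le_zero
    rw [cgf_sub_const (hmom _)] at h1
    have e : Cu θu = -cgf (service Wu Lu eu snru 0) μ (-θu) / θu := by
      rw [hCu, effectiveCapacity, cgf, mgf]
      ring
    rw [e, le_div_iff₀ hθu]
    linarith
  have hdown : ∀ lamd : ℝ → ℝ, (∀ᶠ θ in 𝓝 θd, HasEffectiveBandwidth μ ad θ (lamd θ)) →
      lamd θd ≤ Cd θd := fun lamd hlamd => by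
    rw [hCd]
    exact hqd.effectiveBandwidth_le had hsnrd.measurable_service hsnrd.iIndepFun_service
      hsnrd.identDistrib_service
      (fun η hη => hsnrd.integrable_exp_mul_service hWd.le hLd.le hη)
      (hind.comp measurable_id (measurable_rate_seq Wd Ld ed)) hdecay hθd hlamd
  refine ⟨fun lamd L hlamd hL hlamdL => ?_, fun hadu => ?_⟩
  · have h1 := hdown lamd hlamd
    refine ⟨h1, ?_⟩
    -- Uniqueness of limits identifies `L` with the computed departure rate.
    rwa [← tendsto_nhds_unique hL.2 (hbw θd hθd).2, ← hlamdL]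
  · have h1 : c * departureRate lamu Cu θu (c * θd) ≤ Cd θd := by
      -- Scaling the departures by c also scales the exponent at which their bandwidth is taken, and
      -- this is available at every θ > 0.
      refine hdown (fun θ => c * departureRate lamu Cu θu (c * θ)) ?_
      filter_upwards [lt_mem_nhds hθd] with θ hθ
      rw [hadu]
      exact (hbw (c * θ) (mul_pos hc0 hθ)).const_mul hc0.ne'
    refine ⟨h1, fun hcase => le_trans (mul_le_mul_of_nonneg_left ?_ hc0.le) h1⟩
    rcases le_total 1 c with hc1 | hc1
    · exact hmono _ _ hθd (by nlinarith)
    · rcases hcase with hc1' | hle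
      · exact hmono _ _ hθd (by nlinarith)
      -- Here c θd ≤ θd ≤ θu, so both departure rates equal the arrival rate.
      · rw [departureRate, departureRate, if_pos hle, if_pos (by nlinarith)]
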